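/- Let $A$ be a (not necessarily unital) $C^*$-algebra with positive cone $A_+$. By an ideal of $A$ we mean a two-sided ideal of the ring $A$, that is, an additive subgroup $I\subseteq A$ with $aI\cup Ia\subseteq I$ for all $a\in A$; it is not assumed to be norm-closed or closed under multiplication by complex scalars. Let $I$ be a maximal ideal of $A$, that is, $I\neq A$ and the only ideals $J$ of $A$ with $I\subseteq J$ are $I$ and $A$. Then: 1. $I$ is prime: $I\neq A$, and for all ideals $J,K\subseteq A$, if $JK\subseteq I$ then $J\subseteq I$ or $K\subseteq I$, where $JK$ denotes the additive subgroup generated by $\{xy : x\in J,\ y\in K\}$. 2. $I$ is positively spanned: $I$ is the complex linear span of $I_+:=I\cap A_+$. 3. $I$ is self-adjoint: for all $a\in A$, $a\in I$ if and only if $a^*\in I$. 4. $I$ is closed under scalar multiplication: $\lambda x\in I$ for all $\lambda\in\mathbb{C}$ and $x\in I$. 5. $I$ is hereditary: if $a\in A$ and $x\in I$ satisfy $0\leq a\leq x$, then $a\in I$. -/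

import Mathlib

/-! Ideals in a (not necessarily unital) C*-algebra are modelled by Mathlib's `TwoSidedIdeal`,
that is, additive subgroups `I` with `a * x ∈ I` and `x * a ∈ I` for all `a` in the algebra and
`x ∈ I`. They need not be closed in norm, nor under multiplication by complex scalars. -/

namespace TwoSidedIdeal

section Ring

variable {R : Type*} [NonUnitalRing R]

/-- The product `JK` of two ideals: the additive subgroup generated by all `x * y` with
`x ∈ J` and `y ∈ K`. -/
def productSubgroup (J K : TwoSidedIdeal R) : AddSubgroup R :=
  AddSubgroup.closure {z : R | ∃ x ∈ J, ∃ y ∈ K, z = x * y}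

/-- An ideal `I` is prime if `I ≠ R` and, for all ideals `J`, `K`, whenever `JK ⊆ I` then
`J ⊆ I` or `K ⊆ I`. -/
def IsPrimeIdeal (I : TwoSidedIdeal R) : Prop :=
  I ≠ ⊤ ∧ ∀ J K : TwoSidedIdeal R,
    (productSubgroup J K : Set R) ⊆ (I : Set R) → J ≤ I ∨ K ≤ I

/-- An ideal is maximal if it is maximal among the proper ideals (closed or not). -/
def IsMaximalIdeal (I : TwoSidedIdeal R) : Prop :=
  I ≠ ⊤ ∧ ∀ J : TwoSidedIdeal R, I ≤ J → J ≠ ⊤ → J = I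

end Ring

section CStar

variable {A : Type*} [NonUnitalCStarAlgebra A]

/-- The positive part `I₊ = I ∩ A₊`. -/
def positivePart [PartialOrder A] (I : TwoSidedIdeal A) : Set A :=
  {x : A | x ∈ I ∧ 0 ≤ x}

/-- `I` is the complex linear span of its positive part. -/
def IsPositivelySpanned [PartialOrder A] (I : TwoSidedIdeal A) : Prop :=
  (I : Set A) = (Submodule.span ℂ I.positivePart : Set A)

/-- `a ∈ I` if and only if `a* ∈ I`. -/
def IsSelfAdjointIdeal (I : TwoSidedIdeal A) : Prop :=
  ∀ a : A, a ∈ I ↔ star a ∈ I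

/-- `I` is closed under multiplication by complex scalars. -/
def IsClosedUnderScalars (I : TwoSidedIdeal A) : Prop :=
  ∀ (c : ℂ) (x : A), x ∈ I → c • x ∈ I

/-- Whenever `0 ≤ a ≤ x` with `x ∈ I`, then `a ∈ I`. -/
def IsHereditaryIdeal [PartialOrder A] (I : TwoSidedIdeal A) : Prop :=
  ∀ a x : A, x ∈ I → 0 ≤ a → a ≤ x → a ∈ I

end CStar

end TwoSidedIdeal

/-! Since `I` need not be closed, limits of elements of `I` are useless; convergent series are
instead formed in `A`, with a factor from `I` pulled outside. Factorization: if `star z * z ≤ c ^ 8`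
with `c ≥ 0`, then `z = u * c`. Hence every element of `A` is a product, and maximality gives
primeness and its elementwise form: `k * a * k ∈ I` for all `a` forces `k ∈ I`. Scalar closure
follows at once. Roots: if `c ^ 4 ∈ I`, then `c ^ 3` differs from some `k` by a multiple of `c ^ 4`,
and every `k * a * k` lies in `c ^ 4 A + A c ^ 4 ⊆ I`; so `c ^ 3 ∈ I`. Iterating, positive `b ∈ I`
has `b ^ (1 / 8) ∈ I`. Together: `star z * z ≤ b ∈ I` gives `z = u * c` with positive `c ∈ I`, which
yields the remaining claims. -/

open Filter Topology

/-! ### Functional calculus and convergent factorizations -/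

section ResolventSequences

variable {A : Type*} [NonUnitalCStarAlgebra A] [PartialOrder A] [StarOrderedRing A]

/-- Applied to the scalar functions `Φ n = (f n - f (n + 1)) / t`, `G n = t ^ 3 * f n` and
`E n = 1 - f n`, where `f n = 1 / (1 + 4 ^ n * t ^ 2)`, the functional calculus of a positive
element yields sequences with these algebraic relations and norm bounds. -/
theorem exists_resolvent_sequences {c : A} (hc : 0 ≤ c) :
    ∃ (E G Φ : ℕ → A) (P : A),
      (∀ n, Φ n * c = E (n + 1) - E n) ∧
      (∀ n, (c * c * (c * c)) * Φ n = G n - G (n + 1)) ∧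
      (∀ n, Φ n * (c * c * (c * c)) = G n - G (n + 1)) ∧
      (∀ n, ‖Φ n‖ ≤ 3 * 2 ^ n) ∧
      (∀ n, ‖G n‖ ≤ ‖c‖ * (1 / 4) ^ n) ∧
      E 0 = P * c ∧
      c * c * c - G 0 = (c * c * (c * c)) * P ∧
      (∀ n, star (Φ n) = Φ n) ∧
      (∀ n, star (E n) = E n) ∧
      (∀ n, (c * c * (c * c)) * (c * c * (c * c)) - E n * ((c * c * (c * c)) * (c * c * (c * c)))
        - (c * c * (c * c)) * (c * c * (c * c)) * E n
        + E n * ((c * c * (c * c)) * (c * c * (c * c))) * E n = (c * G n) * (c * G n)) := by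
  have hsa : IsSelfAdjoint c := .of_nonneg hc
  have hcont : ∀ (n : ℕ) (k : ℝ → ℝ), Continuous k →
      Continuous fun t : ℝ ↦ k t / (1 + 4 ^ n * t ^ 2) := fun n k hk ↦
    hk.div (by fun_prop) fun t ↦ by positivity
  have hid : cfcₙ (fun t : ℝ ↦ t) c = c := cfcₙ_id' ℝ c
  have mul : ∀ f g : ℝ → ℝ, Continuous f → Continuous g → f 0 = 0 → g 0 = 0 →
      cfcₙ f c * cfcₙ g c = cfcₙ (fun t ↦ f t * g t) c := fun f g hf hg hf0 hg0 ↦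
    (cfcₙ_mul f g c hf.continuousOn hf0 hg.continuousOn hg0).symm
  have sub : ∀ f g : ℝ → ℝ, Continuous f → Continuous g → f 0 = 0 → g 0 = 0 →
      cfcₙ f c - cfcₙ g c = cfcₙ (fun t ↦ f t - g t) c := fun f g hf hg hf0 hg0 ↦
    (cfcₙ_sub f g c hf.continuousOn hf0 hg.continuousOn hg0).symm
  have add : ∀ f g : ℝ → ℝ, Continuous f → Continuous g → f 0 = 0 → g 0 = 0 →
      cfcₙ f c + cfcₙ g c = cfcₙ (fun t ↦ f t + g t) c := fun f g hf hg hf0 hg0 ↦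
    (cfcₙ_add f g c hf.continuousOn hf0 hg.continuousOn hg0).symm
  let e : ℕ → ℝ → ℝ := fun n t ↦ (4 ^ n * t ^ 2) / (1 + 4 ^ n * t ^ 2)
  let g : ℕ → ℝ → ℝ := fun n t ↦ t ^ 3 / (1 + 4 ^ n * t ^ 2)
  let φ : ℕ → ℝ → ℝ := fun n t ↦
    3 * 4 ^ n * t / (1 + 4 ^ n * t ^ 2) / (1 + 4 ^ (n + 1) * t ^ 2)
  let p : ℝ → ℝ := fun t ↦ t / (1 + 4 ^ 0 * t ^ 2)
  have he : ∀ n, Continuous (e n) := fun n ↦ hcont n _ (by fun_prop)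
  have hg : ∀ n, Continuous (g n) := fun n ↦ hcont n _ (by fun_prop)
  have hφ : ∀ n, Continuous (φ n) := fun n ↦ hcont _ _ (hcont n _ (by fun_prop))
  have hp : Continuous p := hcont 0 _ (by fun_prop)
  have he0 : ∀ n, e n 0 = 0 := by simp [e]
  have hg0 : ∀ n, g n 0 = 0 := by simp [g]
  have hφ0 : ∀ n, φ n 0 = 0 := by simp [φ]
  have hp0 : p 0 = 0 := by simp [p]
  have hc2 : c * c = cfcₙ (fun t : ℝ ↦ t * t) c := by
    have := mul (fun t ↦ t) (fun t ↦ t) (by fun_prop) (by fun_prop) rfl rfl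
    rwa [hid] at this
  have hc4 : c * c * (c * c) = cfcₙ (fun t : ℝ ↦ t ^ 4) c := by
    rw [hc2, mul _ _ (by fun_prop) (by fun_prop) (by simp) (by simp)]
    congr! 2; ring
  have hc3 : c * c * c = cfcₙ (fun t : ℝ ↦ t ^ 3) c := by
    nth_rw 3 [← hid]
    rw [hc2, mul _ _ (by fun_prop) (by fun_prop) (by simp) (by simp)]
    congr! 2; ring
  refine ⟨fun n ↦ cfcₙ (e n) c, fun n ↦ cfcₙ (g n) c, fun n ↦ cfcₙ (φ n) c, cfcₙ p c,
    fun n ↦ ?_, fun n ↦ ?_, fun n ↦ ?_, fun n ↦ ?_, fun n ↦ ?_, ?_, ?_, fun n ↦ ?_, fun n ↦ ?_,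
    fun n ↦ ?_⟩
  · nth_rw 2 [← hid]
    rw [mul _ _ (hφ n) (by fun_prop) (hφ0 n) (by simp), sub _ _ (he _) (he n) (he0 _) (he0 n)]
    congr! 2 with t
    simp only [φ, e]
    field_simp
    ring
  · simp only [hc4]
    rw [mul _ _ (by fun_prop) (hφ n) (by simp) (hφ0 n), sub _ _ (hg _) (hg _) (hg0 _) (hg0 _)]
    congr! 2 with t
    simp only [φ, g]
    field_simp
    ring
  · simp only [hc4]
    rw [mul _ _ (hφ n) (by fun_prop) (hφ0 n) (by simp), sub _ _ (hg _) (hg _) (hg0 _) (hg0 _)]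
    congr! 2 with t
    simp only [φ, g]
    field_simp
    ring
  · refine norm_cfcₙ_le fun t _ ↦ ?_
    simp only [φ, Real.norm_eq_abs, abs_div, abs_mul]
    have h4 : (4 : ℝ) ^ n = 2 ^ n * 2 ^ n := by rw [← mul_pow]; norm_num
    have h2 : (0 : ℝ) < 2 ^ n := by positivity
    rw [abs_of_pos (show (0 : ℝ) < 1 + 4 ^ n * t ^ 2 by positivity),
      abs_of_pos (show (0 : ℝ) < 1 + 4 ^ (n + 1) * t ^ 2 by positivity),
      abs_of_pos (show (0 : ℝ) < 4 ^ n by positivity), abs_of_pos (show (0 : ℝ) < 3 by norm_num)]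
    -- One denominator absorbs `2 ^ n * |t|`; the other is at least `1`.
    have hs : 2 ^ n * |t| ≤ 1 + 4 ^ n * t ^ 2 := by
      rw [h4, ← sq_abs t]
      nlinarith [sq_nonneg (2 ^ n * |t| - 1), sq_nonneg (2 ^ n * |t|)]
    refine (div_le_self (by positivity) (by simp; positivity)).trans ?_
    rw [div_le_iff₀ (by positivity)]
    calc 3 * 4 ^ n * |t| = 3 * 2 ^ n * (2 ^ n * |t|) := by rw [h4]; ring
      _ ≤ _ := by gcongr
  · refine norm_cfcₙ_le fun t ht ↦ ?_
    have htc : |t| ≤ ‖c‖ := by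
      have := norm_apply_le_norm_cfcₙ (fun t : ℝ ↦ t) c ht
      rwa [hid] at this
    have : g n t = t * (t ^ 2 / (1 + 4 ^ n * t ^ 2)) := by simp only [g]; ring
    rw [this, norm_mul, Real.norm_eq_abs, Real.norm_eq_abs]
    gcongr
    rw [abs_of_nonneg (by positivity), div_le_iff₀ (by positivity), one_div, inv_pow,
      inv_mul_eq_div, le_div_iff₀ (by positivity)]
    linarith
  · nth_rw 3 [← hid]
    rw [mul _ _ hp (by fun_prop) hp0 (by simp)]
    congr! 2 with t
    simp only [e, p]
    ring
  · simp only [hc4, hc3]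
    rw [mul _ _ (by fun_prop) hp (by simp) hp0, sub _ _ (by fun_prop) (hg _) (by simp) (hg0 _)]
    congr! 2 with t
    simp only [p, g]
    field_simp
    ring
  · exact (cfcₙ_predicate (φ n) c : IsSelfAdjoint _)
  · exact (cfcₙ_predicate (e n) c : IsSelfAdjoint _)
  · have hcg : c * cfcₙ (g n) c = cfcₙ (fun t ↦ t * g n t) c := by
      nth_rw 1 [← hid]
      rw [mul _ _ (by fun_prop) (hg n) (by simp) (hg0 n)]
    simp only [hc4, hcg]
    have := he n
    have := hg n
    rw [mul _ _ (by fun_prop) (by fun_prop) (by simp) (by simp),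
      mul _ _ (by fun_prop) (by fun_prop) (by simp [he0]) (by simp),
      mul _ _ (by fun_prop) (by fun_prop) (by simp) (by simp [he0]),
      mul _ _ (by fun_prop) (by fun_prop) (by simp [he0]) (by simp [he0]),
      mul _ _ (by fun_prop) (by fun_prop) (by simp) (by simp),
      sub _ _ (by fun_prop) (by fun_prop) (by simp) (by simp [he0]),
      sub _ _ (by fun_prop) (by fun_prop) (by simp [he0]) (by simp [he0]),
      add _ _ (by fun_prop) (by fun_prop) (by simp [he0]) (by simp [he0])]
    congr! 2 with t
    simp only [e, g]
    field_simp
    ring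

/-- Take `k = G 0` and telescope `G n * a * G n`. Each difference carries a factor `c ^ 4`, leaving
terms of size `2 ^ n * 4 ^ (-n)`, so both cofactor series converge. -/
theorem exists_mul_conj_eq_mul_add_mul {c : A} (hc : 0 ≤ c) :
    ∃ k P : A, c * c * c - k = (c * c * (c * c)) * P ∧
      ∀ a, ∃ x y, k * a * k = (c * c * (c * c)) * x + y * (c * c * (c * c)) := by
  obtain ⟨E, G, Φ, P, -, h₁, h₂, hΦ, hG, -, hP, -⟩ := exists_resolvent_sequences hc
  refine ⟨G 0, P, hP, fun a ↦ ?_⟩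
  have hs₁ : Summable fun n ↦ Φ n * a * G n := by
    refine .of_norm_bounded (g := fun n ↦ 3 * ‖a‖ * ‖c‖ * (1 / 2) ^ n)
      (summable_geometric_two.mul_left _) fun n ↦ ?_
    calc ‖Φ n * a * G n‖ ≤ ‖Φ n‖ * ‖a‖ * ‖G n‖ := norm_mul₃_le
      _ ≤ (3 * 2 ^ n) * ‖a‖ * (‖c‖ * (1 / 4) ^ n) := by gcongr <;> apply_assumption
      _ = 3 * ‖a‖ * ‖c‖ * (2 ^ n * (1 / 4) ^ n) := by ring
      _ = _ := by rw [← mul_pow]; norm_num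
  have hs₂ : Summable fun n ↦ G (n + 1) * a * Φ n := by
    refine .of_norm_bounded (g := fun n ↦ 3 * ‖a‖ * ‖c‖ * (1 / 2) ^ n)
      (summable_geometric_two.mul_left _) fun n ↦ ?_
    calc ‖G (n + 1) * a * Φ n‖ ≤ ‖G (n + 1)‖ * ‖a‖ * ‖Φ n‖ := norm_mul₃_le
      _ ≤ (‖c‖ * (1 / 4) ^ n) * ‖a‖ * (3 * 2 ^ n) := by
        gcongr
        · refine (hG _).trans ?_
          gcongr ‖c‖ * ?_
          exact pow_le_pow_of_le_one (by norm_num) (by norm_num) n.le_succ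
        · exact hΦ n
      _ = 3 * ‖a‖ * ‖c‖ * (2 ^ n * (1 / 4) ^ n) := by ring
      _ = _ := by rw [← mul_pow]; norm_num
  have hG0 : Tendsto G atTop (𝓝 0) := by
    refine squeeze_zero_norm hG ?_
    simpa using (tendsto_pow_atTop_nhds_zero_of_lt_one (r := (1 / 4 : ℝ))
      (by norm_num) (by norm_num)).const_mul ‖c‖
  refine ⟨∑' n, Φ n * a * G n, ∑' n, G (n + 1) * a * Φ n, ?_⟩
  have hpart : ∀ N, G 0 * a * G 0 - G N * a * G N =
      (c * c * (c * c)) * ∑ n ∈ Finset.range N, Φ n * a * G n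
      + (∑ n ∈ Finset.range N, G (n + 1) * a * Φ n) * (c * c * (c * c)) := by
    intro N
    induction N with
    | zero => simp
    | succ N ih =>
      rw [Finset.sum_range_succ, Finset.sum_range_succ, mul_add, add_mul, add_add_add_comm, ← ih,
        mul_assoc (G (N + 1) * a), h₂, mul_assoc (Φ N), ← mul_assoc _ (Φ N), h₁]
      noncomm_ring
  have hl : Tendsto (fun N ↦ G 0 * a * G 0 - G N * a * G N) atTop (𝓝 (G 0 * a * G 0)) := by
    simpa using tendsto_const_nhds.sub ((hG0.mul_const a).mul hG0)
  refine tendsto_nhds_unique hl ?_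
  simp_rw [hpart]
  exact (hs₁.hasSum.tendsto_sum_nat.const_mul _).add (hs₂.hasSum.tendsto_sum_nat.mul_const _)

/-- The `E n` act as an approximate unit on `z`, and `z * E n` telescopes into multiples of `c`. The
bound on `star z * z` makes `∑ z * Φ n` converge. -/
theorem exists_eq_mul_of_star_mul_self_le {c z : A} (hc : 0 ≤ c)
    (hz : star z * z ≤ (c * c * (c * c)) * (c * c * (c * c))) : ∃ u, z = u * c := by
  obtain ⟨E, G, Φ, P, hE, h₁, h₂, hΦ, hG, hP, -, hsΦ, hsE, hr⟩ := exists_resolvent_sequences hc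
  set b := c * c * (c * c)
  have hs : Summable fun n ↦ z * Φ n := by
    refine .of_norm_bounded (g := fun n ↦ 2 * ‖c‖ * (1 / 4) ^ n)
      ((summable_geometric_of_lt_one (by norm_num) (by norm_num)).mul_left _) fun n ↦ ?_
    refine abs_le_of_sq_le_sq' ?_ (by positivity) |>.2
    rw [sq, sq, ← CStarRing.norm_star_mul_self]
    have hle : star (z * Φ n) * (z * Φ n) ≤ (G n - G (n + 1)) * (G n - G (n + 1)) := by
      calc star (z * Φ n) * (z * Φ n) = star (Φ n) * (star z * z) * Φ n := by
            rw [star_mul]; noncomm_ring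
        _ ≤ star (Φ n) * (b * b) * Φ n := star_left_conjugate_le_conjugate hz _
        _ = (Φ n * b) * (b * Φ n) := by rw [hsΦ]; noncomm_ring
        _ = _ := by rw [h₁, h₂]
    refine (CStarAlgebra.norm_le_norm_of_nonneg_of_le (star_mul_self_nonneg _) hle).trans ?_
    have hd : ‖G n - G (n + 1)‖ ≤ 2 * ‖c‖ * (1 / 4) ^ n := by
      refine (norm_sub_le _ _).trans ?_
      have h := hG (n + 1)
      have : ‖c‖ * (1 / 4) ^ (n + 1) ≤ ‖c‖ * (1 / 4 : ℝ) ^ n := by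
        gcongr ‖c‖ * ?_
        exact pow_le_pow_of_le_one (by norm_num) (by norm_num) n.le_succ
      linarith [hG n]
    refine (norm_mul_le _ _).trans ?_
    gcongr
  have hlim : Tendsto (fun n ↦ z * E n) atTop (𝓝 z) := by
    obtain ⟨y, hy⟩ := CStarAlgebra.nonneg_iff_eq_star_mul_self.mp (sub_nonneg.mpr hz)
    rw [tendsto_iff_norm_sub_tendsto_zero]
    refine squeeze_zero (fun _ ↦ norm_nonneg _) (g := fun n ↦ ‖c‖ * (‖c‖ * (1 / 4) ^ n))
      (fun n ↦ ?_) ?_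
    · refine abs_le_of_sq_le_sq' ?_ (by positivity) |>.2
      rw [sq, sq, ← CStarRing.norm_star_mul_self]
      have hle : star (z * E n - z) * (z * E n - z) ≤ (c * G n) * (c * G n) := by
        -- Both sides are `(1 - E n) * c ^ 8 * (1 - E n)`, expanded because `A` may lack a unit.
        have hsum : star (z * E n - z) * (z * E n - z) + star (y * E n - y) * (y * E n - y)
            = (c * G n) * (c * G n) := by
          have hb : b * b = star z * z + star y * y := by rw [← hy]; abel
          rw [← hr n, hb]
          simp only [star_sub, star_mul, hsE]
          noncomm_ring
        rw [← hsum]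
        exact le_add_of_nonneg_right (star_mul_self_nonneg _)
      refine (CStarAlgebra.norm_le_norm_of_nonneg_of_le (star_mul_self_nonneg _) hle).trans ?_
      have hd : ‖c * G n‖ ≤ ‖c‖ * (‖c‖ * (1 / 4) ^ n) :=
        (norm_mul_le _ _).trans (by gcongr; exact hG n)
      refine (norm_mul_le _ _).trans ?_
      gcongr
    · simpa using ((tendsto_pow_atTop_nhds_zero_of_lt_one (r := (1 / 4 : ℝ))
        (by norm_num) (by norm_num)).const_mul ‖c‖).const_mul ‖c‖
  refine ⟨z * P + ∑' n, z * Φ n, ?_⟩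
  have hpart : ∀ N, z * E N = (z * P + ∑ n ∈ Finset.range N, z * Φ n) * c := by
    intro N
    induction N with
    | zero => simp [hP, mul_assoc]
    | succ N ih =>
      rw [Finset.sum_range_succ, ← add_assoc, add_mul, ← ih, mul_assoc, hE]
      noncomm_ring
  refine tendsto_nhds_unique hlim ?_
  simp_rw [hpart]
  exact (hs.hasSum.tendsto_sum_nat.const_add _).mul_const _

end ResolventSequences

/-! ### Fractional powers -/

section EighthRoot

open scoped NNReal

variable {A : Type*} [NonUnitalCStarAlgebra A] [PartialOrder A] [StarOrderedRing A]

theorem nnrpow_quarter_fourfold_mul (b : A) {r : ℝ≥0} (hr : 0 < r) :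
    b ^ (r / 4) * b ^ (r / 4) * (b ^ (r / 4) * b ^ (r / 4)) = b ^ r := by
  have h4 : 0 < r / 4 := by positivity
  rw [← CFC.nnrpow_add h4 h4, ← CFC.nnrpow_add (by positivity) (by positivity)]
  congr 1
  ring

theorem exists_eq_mul (z : A) : ∃ u v : A, z = u * v := by
  have h : star z * z = ((star z * z) ^ (1 / 2 : ℝ≥0)) * ((star z * z) ^ (1 / 2 : ℝ≥0)) := by
    rw [← CFC.nnrpow_add (by positivity) (by positivity), add_halves,
      CFC.nnrpow_one _ (star_mul_self_nonneg z)]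
  obtain ⟨u, hu⟩ := exists_eq_mul_of_star_mul_self_le (z := z)
    (c := (star z * z) ^ (1 / 2 / 4 : ℝ≥0)) CFC.nnrpow_nonneg
    (by rw [nnrpow_quarter_fourfold_mul _ (by positivity), ← h])
  exact ⟨u, _, hu⟩

end EighthRoot

/-! ### Maximal ideals -/

namespace TwoSidedIdeal

variable {A : Type*} [NonUnitalCStarAlgebra A] [PartialOrder A] [StarOrderedRing A]
  {I : TwoSidedIdeal A}

theorem IsMaximalIdeal.eq_top_of_mem {R : Type*} [NonUnitalRing R] {I J : TwoSidedIdeal R}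
    (hI : I.IsMaximalIdeal) (h : I ≤ J) {x : R} (hx : x ∈ J) (hxI : x ∉ I) : J = ⊤ := by
  by_contra hJ
  exact hxI (hI.2 J h hJ ▸ hx)

theorem IsMaximalIdeal.isPrimeIdeal (hI : I.IsMaximalIdeal) : I.IsPrimeIdeal := by
  refine ⟨hI.1, fun J K hJK ↦ ?_⟩
  by_contra! h
  obtain ⟨hJ, hK⟩ := h
  obtain ⟨j, hjJ, hjI⟩ := SetLike.not_le_iff_exists.mp hJ
  obtain ⟨k, hkK, hkI⟩ := SetLike.not_le_iff_exists.mp hK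
  have hJt := hI.eq_top_of_mem (le_sup_left (b := J)) (le_sup_right (a := I) hjJ) hjI
  have hKt := hI.eq_top_of_mem (le_sup_left (b := K)) (le_sup_right (a := I) hkK) hkI
  refine hI.1 (eq_top_iff.mpr fun a _ ↦ ?_)
  obtain ⟨u, v, rfl⟩ := exists_eq_mul a
  obtain ⟨i, hi, j, hj, rfl⟩ := mem_sup.mp (hJt ▸ mem_top A : u ∈ I ⊔ J)
  obtain ⟨i', hi', k, hk, rfl⟩ := mem_sup.mp (hKt ▸ mem_top A : v ∈ I ⊔ K)
  rw [add_mul, mul_add j]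
  exact I.add_mem (I.mul_mem_right _ _ hi) (I.add_mem (I.mul_mem_left _ _ hi')
    (hJK (AddSubgroup.subset_closure ⟨j, hj, k, hk, rfl⟩)))

/-- If `k ∉ I`, maximality applied to `L`, then to `M`, together with `A = AA`, forces `kA ⊆ I` and
then `A ⊆ I`. -/
theorem IsMaximalIdeal.mem_of_forall_mul_mul_mem (hI : I.IsMaximalIdeal) {k : A}
    (hk : ∀ a, k * a * k ∈ I) : k ∈ I := by
  by_contra hkI
  let L : TwoSidedIdeal A := .mk' {x | ∀ a, k * a * x ∈ I}
    (fun a ↦ by simp)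
    (fun hx hy a ↦ by rw [mul_add]; exact I.add_mem (hx a) (hy a))
    (fun hx a ↦ by rw [mul_neg]; exact I.neg_mem (hx a))
    (fun {r _} hx a ↦ by rw [← mul_assoc, mul_assoc k]; exact hx (a * r))
    (fun hx a ↦ by rw [← mul_assoc]; exact I.mul_mem_right _ _ (hx a))
  have hL : L = ⊤ := hI.eq_top_of_mem
    (fun x hx ↦ (mem_mk' ..).mpr fun a ↦ I.mul_mem_left _ _ hx) ((mem_mk' ..).mpr hk) hkI
  let M : TwoSidedIdeal A := .mk' {x | ∀ a, x * a ∈ I}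
    (fun a ↦ by simp)
    (fun hx hy a ↦ by rw [add_mul]; exact I.add_mem (hx a) (hy a))
    (fun hx a ↦ by rw [neg_mul]; exact I.neg_mem (hx a))
    (fun hx a ↦ by rw [mul_assoc]; exact I.mul_mem_left _ _ (hx a))
    (fun {_ r} hx a ↦ by rw [mul_assoc]; exact hx (r * a))
  have hM : M = ⊤ := by
    refine hI.eq_top_of_mem (fun x hx ↦ (mem_mk' ..).mpr fun a ↦ I.mul_mem_right _ _ hx)
      ((mem_mk' ..).mpr fun a ↦ ?_) hkI
    obtain ⟨u, v, rfl⟩ := exists_eq_mul a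
    have hv : v ∈ L := hL ▸ mem_top A
    rw [← mul_assoc]
    exact (mem_mk' ..).mp hv u
  refine hI.1 (eq_top_iff.mpr fun a _ ↦ ?_)
  obtain ⟨u, v, rfl⟩ := exists_eq_mul a
  have hu : u ∈ M := hM ▸ mem_top A
  exact (mem_mk' ..).mp hu v

theorem IsMaximalIdeal.isClosedUnderScalars (hI : I.IsMaximalIdeal) :
    I.IsClosedUnderScalars := fun l x hx ↦
  hI.mem_of_forall_mul_mul_mem fun a ↦ by
    rw [smul_mul_assoc, smul_mul_assoc, ← mul_smul_comm, mul_assoc]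
    exact I.mul_mem_right _ _ hx

theorem IsMaximalIdeal.cube_mem (hI : I.IsMaximalIdeal) {c : A} (hc : 0 ≤ c)
    (h : c * c * (c * c) ∈ I) : c * c * c ∈ I := by
  obtain ⟨k, P, hP, hk⟩ := exists_mul_conj_eq_mul_add_mul hc
  have hkI : k ∈ I := hI.mem_of_forall_mul_mul_mem fun a ↦ by
    obtain ⟨x, y, hxy⟩ := hk a
    rw [hxy]
    exact I.add_mem (I.mul_mem_right _ _ h) (I.mul_mem_left _ _ h)
  rw [← sub_add_cancel (c * c * c) k, hP]
  exact I.add_mem (I.mul_mem_right _ _ h) hkI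

open scoped NNReal in
theorem IsMaximalIdeal.nnrpow_half_mem (hI : I.IsMaximalIdeal) {b : A} {r : ℝ≥0} (hr : 0 < r)
    (h : b ^ r ∈ I) : b ^ (r / 2) ∈ I := by
  have step : ∀ s : ℝ≥0, 0 < s → b ^ s ∈ I → b ^ (3 / 4 * s) ∈ I := by
    intro s hs h
    have := hI.cube_mem (c := b ^ (s / 4)) CFC.nnrpow_nonneg
      (by rwa [nnrpow_quarter_fourfold_mul b hs])
    rw [← CFC.nnrpow_add (by positivity) (by positivity),
      ← CFC.nnrpow_add (by positivity) (by positivity)] at this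
    convert this using 2
    ring
  -- Three steps suffice, since `(3 / 4) ^ 3 = 27 / 64 < 1 / 2`.
  have h3 := step _ (by positivity) (step _ (by positivity) (step r hr h))
  have : r / 2 = 3 / 4 * (3 / 4 * (3 / 4 * r)) + 5 / 64 * r := by
    rw [← NNReal.coe_inj]; push_cast; ring
  rw [this, CFC.nnrpow_add (by positivity) (by positivity)]
  exact I.mul_mem_right _ _ h3

open scoped NNReal in
theorem IsMaximalIdeal.exists_mem_eq_mul (hI : I.IsMaximalIdeal) {b z : A} (hb : b ∈ I)
    (hz : star z * z ≤ b) : ∃ u, ∃ c ∈ I, 0 ≤ c ∧ z = u * c := by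
  have hb0 : 0 ≤ b := (star_mul_self_nonneg z).trans hz
  have h1 : b ^ (1 : ℝ≥0) ∈ I := by rwa [CFC.nnrpow_one b]
  have h8 := hI.nnrpow_half_mem (by positivity) (hI.nnrpow_half_mem (by positivity)
    (hI.nnrpow_half_mem one_pos h1))
  rw [div_div (1 / 2 : ℝ≥0), show (2 * 2 : ℝ≥0) = 4 by norm_num] at h8
  obtain ⟨u, hu⟩ := exists_eq_mul_of_star_mul_self_le (z := z)
    (c := b ^ (1 / 2 / 4 : ℝ≥0)) CFC.nnrpow_nonneg (by
      rwa [nnrpow_quarter_fourfold_mul _ (by positivity),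
        ← CFC.nnrpow_add (by positivity) (by positivity), add_halves, CFC.nnrpow_one b])
  exact ⟨u, _, h8, CFC.nnrpow_nonneg, hu⟩

theorem IsMaximalIdeal.star_mem (hI : I.IsMaximalIdeal) {x : A} (hx : x ∈ I) : star x ∈ I := by
  obtain ⟨u, c, hc, hc0, rfl⟩ := hI.exists_mem_eq_mul (I.mul_mem_left (star x) x hx) le_rfl
  rw [star_mul, (IsSelfAdjoint.of_nonneg hc0).star_eq]
  exact I.mul_mem_right _ _ hc

theorem IsMaximalIdeal.isSelfAdjointIdeal (hI : I.IsMaximalIdeal) : I.IsSelfAdjointIdeal :=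
  fun a ↦ ⟨hI.star_mem, fun h ↦ star_star a ▸ hI.star_mem h⟩

theorem IsMaximalIdeal.isHereditaryIdeal (hI : I.IsMaximalIdeal) : I.IsHereditaryIdeal := by
  intro a x hx ha hax
  obtain ⟨z, rfl⟩ := CStarAlgebra.nonneg_iff_eq_star_mul_self.mp ha
  obtain ⟨u, c, hc, -, rfl⟩ := hI.exists_mem_eq_mul hx hax
  exact I.mul_mem_left _ _ (I.mul_mem_left _ _ hc)

theorem IsMaximalIdeal.posPart_mem (hI : I.IsMaximalIdeal) {x : A} (hx : x ∈ I)
    (hsa : IsSelfAdjoint x) : x⁺ ∈ I := by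
  have hmem : star x⁺ * x⁺ = x * x⁺ := by
    rw [(IsSelfAdjoint.of_nonneg (CFC.posPart_nonneg x)).star_eq]
    have h := congr($(CFC.posPart_sub_negPart x) * x⁺)
    rwa [sub_mul, CFC.negPart_mul_posPart, sub_zero] at h
  obtain ⟨u, c, hc, -, h⟩ := hI.exists_mem_eq_mul (I.mul_mem_right _ x⁺ hx) hmem.le
  rw [h]
  exact I.mul_mem_left _ _ hc

theorem IsMaximalIdeal.mem_span_of_isSelfAdjoint (hI : I.IsMaximalIdeal) {x : A} (hx : x ∈ I)
    (hsa : IsSelfAdjoint x) : x ∈ Submodule.span ℂ I.positivePart := by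
  have hp := hI.posPart_mem hx hsa
  have hn := hI.posPart_mem (I.neg_mem hx) hsa.neg
  rw [CFC.posPart_neg] at hn
  rw [← CFC.posPart_sub_negPart x]
  exact Submodule.sub_mem _ (Submodule.subset_span ⟨hp, CFC.posPart_nonneg x⟩)
    (Submodule.subset_span ⟨hn, CFC.negPart_nonneg x⟩)

theorem IsMaximalIdeal.isPositivelySpanned (hI : I.IsMaximalIdeal) : I.IsPositivelySpanned := by
  have hsmul := hI.isClosedUnderScalars
  refine Set.Subset.antisymm (fun x hx ↦ ?_) fun x hx ↦ ?_
  · have hadd : ∀ y ∈ I, y + star y ∈ Submodule.span ℂ I.positivePart := fun y hy ↦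
      hI.mem_span_of_isSelfAdjoint (I.add_mem hy (hI.star_mem hy)) (.add_star_self y)
    have h₁ := hadd x hx
    have h₂ := hadd _ (hsmul Complex.I x hx)
    -- Scalar closure puts `Complex.I • x` in `I`, so the imaginary part is handled like the real
    -- one.
    have h : x = (1 / 2 : ℂ) • (x + star x)
        - (Complex.I / 2) • (Complex.I • x + star (Complex.I • x)) := by
      rw [star_smul]
      simp only [smul_add, smul_smul, Complex.star_def, Complex.conj_I]
      rw [show Complex.I / 2 * Complex.I = -(1 / 2) by
          rw [div_mul_eq_mul_div, Complex.I_mul_I]; norm_num,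
        show Complex.I / 2 * -Complex.I = 1 / 2 by
          rw [div_mul_eq_mul_div, mul_neg, Complex.I_mul_I]; norm_num]
      module
    rw [h]
    exact Submodule.sub_mem _ (Submodule.smul_mem _ _ h₁) (Submodule.smul_mem _ _ h₂)
  · refine Submodule.span_induction (p := fun y _ ↦ y ∈ I) (fun y hy ↦ hy.1) I.zero_mem
      (fun _ _ _ _ ↦ I.add_mem) (fun l y _ ↦ hsmul l y) hx

end TwoSidedIdeal

/-- The order on `A` is the usual one: by `StarOrderedRing`, `0 ≤ x` means that `x` is a finite
sum of elements `star y * y`, and `a ≤ b` means `0 ≤ b - a`. -/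
theorem proposition4p12 {A : Type*} [NonUnitalCStarAlgebra A] [PartialOrder A]
    [StarOrderedRing A] (I : TwoSidedIdeal A) (hI : I.IsMaximalIdeal) :
    I.IsPrimeIdeal ∧ I.IsPositivelySpanned ∧ I.IsSelfAdjointIdeal ∧
      I.IsClosedUnderScalars ∧ I.IsHereditaryIdeal :=
  ⟨hI.isPrimeIdeal, hI.isPositivelySpanned, hI.isSelfAdjointIdeal, hI.isClosedUnderScalars,
    hI.isHereditaryIdeal⟩
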